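/- Let $\mathcal H\cong\mathbb C^d$ be a finite-dimensional Hilbert space, let a state on a finite-dimensional Hilbert space be a positive semidefinite operator of trace $1$, and let $\mathfrak S$ be the set of states on $\mathcal H$, with its usual topology and Borel $\sigma$-algebra. Let $\rho^{(n)}$, $n\ge 1$, be an exchangeable sequence of states: $\rho^{(n)}$ is a state on $\mathcal H^{\otimes n}$, $U(\pi)\rho^{(n)}U(\pi)^\dagger=\rho^{(n)}$ for every permutation $\pi\in S_n$ (where $U(\pi)$ permutes the $n$ tensor factors), and $\rho^{(n)}=\operatorname{tr}_{n+1}\rho^{(n+1)}$ for all $n\ge 1$. Then there is a unique Borel probability measure $P$ on $\mathfrak S$ (the de Finetti measure) such that $$\rho^{(n)}=\int_{\mathfrak S}\rho^{\otimes n}\,dP(\rho)\qquad\text{for all } n\ge 1,$$ and it has the following properties. (1) Let $R$ be a self-adjoint operator on $\mathcal H$ and $r\in\mathbb R$ such that $R-r\mathbb 1$ is positive semidefinite and $\operatorname{tr}(R\rho^{(1)})=r$. Then $P$ is supported on the states $\rho$ with $\operatorname{tr}(R\rho)=r$: this equality holds for $P$-almost every $\rho$ and for every $\rho$ in the topological support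 of $P$. Hence $$\rho^{(n)}=\int_{\{\rho\in\mathfrak S\,:\,\operatorname{tr}(R\rho)=r\}}\rho^{\otimes n}\,dP(\rho)\qquad\text{for all } n\ge 1.$$ (2) Consequently, an outcome that never occurs in a single trial has zero probability under the "unknown state": if $E$ is a measurement operator, $0\le E\le\mathbb 1$, with $\operatorname{tr}(E\rho^{(1)})=0$, then $\operatorname{tr}(E\rho)=0$ for $P$-almost every $\rho$ and for every $\rho$ in the topological support of $P$. -/

import Mathlib

open MeasureTheory
open scoped ComplexOrder

namespace QDeFinetti

variable {d : Type*} [Fintype d] [DecidableEq d]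

/-- An operator on the `n`-fold tensor power of the single-trial Hilbert space `ℂ^d`, written as a
matrix in the product basis, whose elements are labelled by the words `μ : Fin n → d`. -/
abbrev TrialOp (d : Type*) (n : ℕ) : Type _ := Matrix (Fin n → d) (Fin n → d) ℂ

/-- A density operator: positive semidefinite with unit trace. -/
def IsState {ι : Type*} [Fintype ι] (A : Matrix ι ι ℂ) : Prop :=
  A.PosSemidef ∧ A.trace = 1

/-- The space of single-trial density operators, with the topology inherited from the space of
matrices and the Borel σ-algebra. -/
def StateSpace (d : Type*) [Fintype d] : Type _ := {σ : Matrix d d ℂ // IsState σ}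

instance : TopologicalSpace (StateSpace d) :=
  inferInstanceAs (TopologicalSpace {σ : Matrix d d ℂ // IsState σ})

instance : MeasurableSpace (StateSpace d) := borel _

instance : BorelSpace (StateSpace d) := ⟨rfl⟩

/-- The permutation operator `U(π) = ∑_μ |μ_{π(1)} … μ_{π(n)}⟩⟨μ_1 … μ_n|`. -/
def permOp (d : Type*) [DecidableEq d] {n : ℕ} (π : Equiv.Perm (Fin n)) : TrialOp d n :=
  Matrix.of fun ν μ => if ν = μ ∘ π then 1 else 0

/-- The partial trace over the last of `n + 1` trials. -/
def traceLast {n : ℕ} (A : TrialOp d (n + 1)) : TrialOp d n :=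
  Matrix.of fun μ ν => ∑ k : d, A (Fin.snoc μ k) (Fin.snoc ν k)

/-- The tensor power `σ^{⊗ n}`. -/
def tensorPower (σ : Matrix d d ℂ) (n : ℕ) : TrialOp d n :=
  Matrix.of fun μ ν => ∏ k : Fin n, σ (μ k) (ν k)

/-- A one-trial operator, seen as an operator on the single-trial space itself (words of length one
are identified with letters). -/
def singleTrial (A : TrialOp d 1) : Matrix d d ℂ :=
  Matrix.of fun a b => A (fun _ => a) (fun _ => b)

/-- The sequence `ρ^{(n)}`, `n ≥ 1`, is an exchangeable sequence of states: every member is a state,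
invariant under all permutations of trials, and is recovered from the next member by tracing out the
last trial. The value at `n = 0` is irrelevant. -/
structure IsExchangeable (ρ : ∀ n : ℕ, TrialOp d n) : Prop where
  isState : ∀ n, 1 ≤ n → IsState (ρ n)
  symmetric : ∀ n, 1 ≤ n → ∀ π : Equiv.Perm (Fin n),
    permOp d π * ρ n * (permOp d π).conjTranspose = ρ n
  extendible : ∀ n, 1 ≤ n → ρ n = traceLast (ρ (n + 1))

/-- `P` is a de Finetti measure of the sequence `ρ^{(n)}`, `n ≥ 1`: it is a Borel probability measure
on the space of single-trial states with `ρ^{(n)} = ∫ σ^{⊗ n} dP(σ)`. The operator-valued integral is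
taken entry by entry; the integrands are continuous and bounded. -/
structure IsDeFinettiMeasure (ρ : ∀ n : ℕ, TrialOp d n) (P : Measure (StateSpace d)) : Prop where
  isProbability : IsProbabilityMeasure P
  representation : ∀ n, 1 ≤ n → ∀ μ ν : Fin n → d,
    ρ n μ ν = ∫ σ : StateSpace d, tensorPower σ.1 n μ ν ∂P

/-- A measurement operator (effect) `E`, `0 ≤ E ≤ 1`: the operator of one outcome of a measurement,
which occurs in a state `σ` with probability `tr (E σ)`. -/
def IsEffect (E : Matrix d d ℂ) : Prop :=
  E.PosSemidef ∧ (1 - E).PosSemidef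

end QDeFinetti

/-! Existence is state tomography pushed to a limit. Fix an informationally complete measurement `E`
with dual matrices `D` (`exists_informationallyComplete`), perform it on each of `N` trials, and
average `D` over the outcomes. The law of this estimate is a probability measure on a compact box of
Hermitian matrices. Its `n`-th tensor moment is an average over maps `Fin n → Fin N`: by symmetry
and extendibility each injective map contributes exactly `ρ n`
(`IsExchangeable.sum_trace_mul_prod`), and the remaining maps are a vanishing fraction. A weak limit
point of the laws therefore represents every `ρ n`.

The estimates need not be positive, so the limit must still be shown to live on states. For an
effect `E`, the moments of `tr (E σ)` are the probabilities of obtaining `E` in all trials, hence at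
most one; this forces `|tr (E σ)| ≤ 1` almost surely, and suitable effects then give trace one and
positivity (`IsExchangeable.ae_isState`).

Uniqueness is Stone–Weierstrass: the monomials in the matrix entries are entries of tensor powers.
As for the constraint, `tr (R σ) - r` is nonnegative on states and has mean zero, so it vanishes
almost everywhere; the level set is closed, so it contains the support. -/

open Matrix

/-! ### Positive semidefinite matrices. -/

/-- The product of two positive semidefinite matrices has nonnegative trace. -/
theorem Matrix.PosSemidef.trace_mul_nonneg {ι : Type*} [Fintype ι] [DecidableEq ι]
    {A B : Matrix ι ι ℂ} (hA : A.PosSemidef) (hB : B.PosSemidef) : 0 ≤ (A * B).trace := by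
  open scoped MatrixOrder in
  obtain ⟨C, rfl⟩ := CStarAlgebra.nonneg_iff_eq_star_mul_self.mp hB.nonneg
  rw [star_eq_conjTranspose, ← Matrix.mul_assoc, Matrix.trace_mul_comm, ← Matrix.mul_assoc]
  exact (hA.mul_mul_conjTranspose_same C).trace_nonneg

/-- A positive semidefinite matrix is bounded by a positive multiple of the identity. -/
theorem Matrix.PosSemidef.exists_smul_one_sub {ι : Type*} [Fintype ι] [DecidableEq ι]
    {A : Matrix ι ι ℂ} (hA : A.PosSemidef) :
    ∃ c : ℝ, 0 < c ∧ ((c : ℂ) • (1 : Matrix ι ι ℂ) - A).PosSemidef := by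
  open scoped MatrixOrder Matrix.Norms.L2Operator in
  have h := IsSelfAdjoint.le_algebraMap_norm_self (a := A) hA.isHermitian
  -- The added `1` keeps the constant positive when `A = 0`.
  refine ⟨‖A‖ + 1, by positivity, ?_⟩
  have h1 := (Matrix.le_iff.mp h).add PosSemidef.one
  have h2 : ((‖A‖ + 1 : ℝ) : ℂ) • (1 : Matrix ι ι ℂ) - A
      = algebraMap ℝ (Matrix ι ι ℂ) ‖A‖ - A + 1 := by
    rw [Algebra.algebraMap_eq_smul_one]
    ext i j
    simp
    ring
  rw [h2]
  exact h1

/-! ### Tensor products of single-trial operators. -/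

namespace QDeFinetti

variable {d : Type*} {n : ℕ}

/-- The tensor product `G 0 ⊗ ⋯ ⊗ G (n - 1)` of single-trial operators. -/
def tensorProd (G : Fin n → Matrix d d ℂ) : TrialOp d n :=
  Matrix.of fun μ ν => ∏ k, G k (μ k) (ν k)

theorem tensorProd_apply (G : Fin n → Matrix d d ℂ) (μ ν : Fin n → d) :
    tensorProd G μ ν = ∏ k, G k (μ k) (ν k) := rfl

theorem tensorProd_const (σ : Matrix d d ℂ) : tensorProd (fun _ : Fin n => σ) = tensorPower σ n :=
  rfl

theorem conjTranspose_tensorProd (G : Fin n → Matrix d d ℂ) :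
    (tensorProd G)ᴴ = tensorProd fun k => (G k)ᴴ := by
  ext μ ν
  simp [tensorProd_apply, Matrix.conjTranspose_apply]

theorem tensorProd_one [DecidableEq d] : tensorProd (fun _ : Fin n => (1 : Matrix d d ℂ)) = 1 := by
  ext μ ν
  simp only [tensorProd_apply, Matrix.one_apply]
  rw [Finset.prod_ite_zero]
  simp [funext_iff]

variable [Fintype d]

theorem tensorProd_mul (F G : Fin n → Matrix d d ℂ) :
    tensorProd F * tensorProd G = tensorProd fun k => F k * G k := by
  classical
  ext μ ν
  simp only [tensorProd_apply, Matrix.mul_apply, Finset.prod_univ_sum, Fintype.piFinset_univ,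
    Finset.prod_mul_distrib]

theorem trace_tensorProd (G : Fin n → Matrix d d ℂ) :
    (tensorProd G).trace = ∏ k, (G k).trace := by
  classical
  simp only [Matrix.trace, Matrix.diag, tensorProd_apply, Finset.prod_univ_sum,
    Fintype.piFinset_univ]

omit [Fintype d] in
/-- Multilinearity of the tensor product: it distributes over sums in every factor. -/
theorem tensorProd_sum {X : Type*} [Fintype X] (E : X → Matrix d d ℂ)
    (c : Fin n → X → ℂ) :
    tensorProd (fun k => ∑ a, c k a • E a) =
      ∑ x : Fin n → X, (∏ k, c k (x k)) • tensorProd fun k => E (x k) := by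
  classical
  ext μ ν
  simp only [tensorProd_apply, Matrix.sum_apply, Matrix.smul_apply, Finset.prod_univ_sum,
    Fintype.piFinset_univ, smul_eq_mul, Finset.prod_mul_distrib]

theorem posSemidef_tensorProd [DecidableEq d] {G : Fin n → Matrix d d ℂ}
    (hG : ∀ k, (G k).PosSemidef) : (tensorProd G).PosSemidef := by
  open scoped MatrixOrder in
  choose C hC using fun k => CStarAlgebra.nonneg_iff_eq_star_mul_self.mp (hG k).nonneg
  have : tensorProd G = (tensorProd C)ᴴ * tensorProd C := by
    rw [conjTranspose_tensorProd, tensorProd_mul]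
    exact congrArg _ (funext hC)
  rw [this]
  exact posSemidef_conjTranspose_mul_self _

/-- The probability of obtaining an effect in each of `n` trials lies between `0` and `1`. -/
theorem IsState.trace_mul_tensorPower_mem [DecidableEq d] {A : TrialOp d n} (hA : IsState A)
    {E : Matrix d d ℂ} (hE : IsEffect E) :
    0 ≤ (A * tensorPower E n).trace ∧ (A * tensorPower E n).trace ≤ 1 := by
  classical
  have hpos : ∀ x : Fin n → Bool,
      0 ≤ (A * tensorProd fun k => bif x k then E else 1 - E).trace := fun x =>
    hA.1.trace_mul_nonneg (posSemidef_tensorProd fun k => by cases x k; exacts [hE.2, hE.1])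
  have htrue : tensorPower E n = tensorProd fun k : Fin n => bif (fun _ => true) k then E else 1 - E :=
    rfl
  refine ⟨htrue ▸ hpos _, ?_⟩
  -- Expanding the tensor power of `1 = E + (1 - E)` splits the total probability over the `2 ^ n`
  -- outcome words.
  have hsum := tensorProd_sum (n := n) (fun b : Bool => bif b then E else 1 - E) fun _ _ => 1
  have hone : (fun k : Fin n => ∑ a : Bool, (1 : ℂ) • (bif a then E else 1 - E)) = fun _ => 1 := by
    funext k; simp
  rw [hone, tensorProd_one] at hsum
  have htot : (1 : ℂ) = ∑ x : Fin n → Bool,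
      (A * tensorProd fun k => bif x k then E else 1 - E).trace := by
    rw [← Matrix.trace_sum, ← Matrix.mul_sum, ← hA.2]
    simp only [Finset.prod_const_one, one_smul] at hsum
    rw [← hsum, Matrix.mul_one]
  rw [htot, htrue]
  exact Finset.single_le_sum (f := fun x : Fin n → Bool =>
    (A * tensorProd fun k => bif x k then E else 1 - E).trace) (fun x _ => hpos x)
    (Finset.mem_univ _)

/-- Measuring nothing in the last trial amounts to tracing it out. -/
theorem trace_mul_tensorProd_snoc_one [DecidableEq d] (A : TrialOp d (n + 1))
    (G : Fin n → Matrix d d ℂ) :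
    (A * tensorProd (Fin.snoc G 1)).trace = (traceLast A * tensorProd G).trace := by
  simp only [Matrix.trace, Matrix.diag, Matrix.mul_apply, traceLast, Matrix.of_apply,
    tensorProd_apply, Fin.prod_univ_castSucc, Fin.snoc_castSucc, Fin.snoc_last]
  rw [← (Fin.snocEquiv (fun _ : Fin (n + 1) => d)).sum_comp, Fintype.sum_prod_type_right]
  refine Finset.sum_congr rfl fun μ _ => ?_
  simp_rw [← (Fin.snocEquiv (fun _ : Fin (n + 1) => d)).sum_comp (fun ν => A _ ν * _),
    Fintype.sum_prod_type_right]
  rw [Finset.sum_comm]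
  refine Finset.sum_congr rfl fun ν _ => ?_
  simp [Fin.snocEquiv, Matrix.one_apply, Finset.sum_mul]

end QDeFinetti

/-! ### Local measurements on exchangeable states. -/

open Matrix

namespace QDeFinetti

variable {d : Type*} [Fintype d] [DecidableEq d] {n : ℕ} {ρ : ∀ n : ℕ, TrialOp d n}

theorem trace_mul_tensorProd_single (A : TrialOp d n) (μ ν : Fin n → d) :
    (A * tensorProd fun k => Matrix.single (ν k) (μ k) (1 : ℂ)).trace = A μ ν := by
  have : (tensorProd fun k => Matrix.single (ν k) (μ k) (1 : ℂ)) = Matrix.single ν μ 1 := by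
    ext α β
    simp only [tensorProd_apply, Matrix.single_apply]
    rw [Finset.prod_ite_zero]
    simp [funext_iff, forall_and]
  rw [this, Matrix.trace_mul_single]
  simp

theorem IsExchangeable.apply_comp_perm (hρ : IsExchangeable ρ) (hn : 1 ≤ n)
    (π : Equiv.Perm (Fin n)) (μ ν : Fin n → d) : ρ n (μ ∘ π) (ν ∘ π) = ρ n μ ν := by
  have hinj : ∀ α β : Fin n → d, α ∘ π = β ∘ π ↔ α = β := fun α β =>
    π.surjective.injective_comp_right.eq_iff
  conv_lhs => rw [← hρ.symmetric n hn π]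
  simp [Matrix.mul_apply, permOp, Matrix.conjTranspose_apply, hinj]

theorem IsExchangeable.trace_mul_tensorProd_comp_perm (hρ : IsExchangeable ρ) (hn : 1 ≤ n)
    (π : Equiv.Perm (Fin n)) (G : Fin n → Matrix d d ℂ) :
    (ρ n * tensorProd (G ∘ π)).trace = (ρ n * tensorProd G).trace := by
  simp only [Matrix.trace, Matrix.diag, Matrix.mul_apply, tensorProd_apply]
  rw [← (π.arrowCongr (Equiv.refl d)).symm.sum_comp]
  refine Finset.sum_congr rfl fun μ _ => ?_
  rw [← (π.arrowCongr (Equiv.refl d)).symm.sum_comp]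
  refine Finset.sum_congr rfl fun ν _ => ?_
  refine congrArg₂ _ (hρ.apply_comp_perm hn π μ ν) ?_
  exact Equiv.prod_comp π fun k => G k (ν k) (μ k)

/-- Unmeasured trials do not matter: each identity factor at the end is one partial trace, which
extendibility absorbs. -/
theorem IsExchangeable.trace_mul_tensorProd_append_one (hρ : IsExchangeable ρ) (hn : 1 ≤ n)
    (G : Fin n → Matrix d d ℂ) (m : ℕ) :
    (ρ (n + m) * tensorProd (Fin.append G fun _ : Fin m => 1)).trace =
      (ρ n * tensorProd G).trace := by
  induction m with
  | zero =>
    have : Fin.append G (fun _ : Fin 0 => (1 : Matrix d d ℂ)) = G := by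
      ext1 i; exact Fin.append_left G _ i
    rw [this]; rfl
  | succ m ih =>
    have : Fin.append G (fun _ : Fin (m + 1) => (1 : Matrix d d ℂ)) =
        (Fin.snoc (Fin.append G fun _ : Fin m => 1) 1 :
          Fin (n + m + 1) → Matrix d d ℂ) := by
      rw [← Fin.append_snoc]
      congr 1
      ext1 i
      refine Fin.lastCases ?_ (fun j => ?_) i <;> simp
    rw [this]
    change (ρ (n + m + 1) * _).trace = _
    rw [trace_mul_tensorProd_snoc_one, ← hρ.extendible (n + m) (by omega), ih]

/-- The empirical estimates of the entries at distinct trials reproduce the entries of `ρ n`. -/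
theorem IsExchangeable.sum_trace_mul_prod (hρ : IsExchangeable ρ) (hn : 1 ≤ n)
    {X : Type*} [Fintype X] {E D : X → Matrix d d ℂ} (hE : ∑ x, E x = 1)
    (hD : ∀ i j, ∑ x, D x i j • E x = Matrix.single j i 1) {N : ℕ} (i : Fin n ↪ Fin N)
    (μ ν : Fin n → d) :
    ∑ x : Fin N → X, (ρ N * tensorProd fun k => E (x k)).trace *
      ∏ l, D (x (i l)) (μ l) (ν l) = ρ n μ ν := by
  obtain ⟨m, rfl⟩ : ∃ m, N = n + m :=
    Nat.exists_eq_add_of_le (by simpa using Fintype.card_le_of_embedding i)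
  -- Some permutation carries the first `n` trials to the chosen ones, so by symmetry `i` may be
  -- taken to be `Fin.castAdd m`.
  obtain ⟨π, hπ⟩ := Equiv.Perm.exists_extending_pair (Fin.castAdd m) i
    (Fin.castAdd_injective n m) i.injective
  rw [← (π.arrowCongr (Equiv.refl X)).sum_comp]
  have h1 : ∀ x : Fin (n + m) → X,
      (ρ (n + m) * tensorProd fun k => E ((π.arrowCongr (Equiv.refl X)) x k)).trace *
        ∏ l, D ((π.arrowCongr (Equiv.refl X)) x (i l)) (μ l) (ν l) =
      (ρ (n + m) * tensorProd fun k => E (x k)).trace *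
        ∏ k, (Fin.append (fun l a => D a (μ l) (ν l)) fun (_ : Fin m) _ => 1 :
          Fin (n + m) → X → ℂ) k (x k) := by
    intro x
    congr 1
    · exact hρ.trace_mul_tensorProd_comp_perm (by omega) π.symm fun k => E (x k)
    · simp [Fin.prod_univ_add, Equiv.arrowCongr_apply, ← hπ]
  simp_rw [h1]
  rw [← trace_mul_tensorProd_single (ρ n) μ ν, ← hρ.trace_mul_tensorProd_append_one hn _ m]
  -- Summing over outcomes turns a factor weighted by `D` into a matrix unit and an unweighted
  -- factor into the identity.
  have h2 : (Fin.append (fun k => Matrix.single (ν k) (μ k) (1 : ℂ)) fun _ : Fin m => 1) =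
      fun k => ∑ a, (Fin.append (fun l a => D a (μ l) (ν l)) fun (_ : Fin m) _ => 1 :
          Fin (n + m) → X → ℂ) k a • E a := by
    ext1 k
    refine Fin.addCases (fun l => ?_) (fun l => ?_) k <;> simp [hD, hE]
  rw [h2, tensorProd_sum, Matrix.mul_sum, Matrix.trace_sum]
  refine Finset.sum_congr rfl fun x _ => ?_
  rw [Matrix.mul_smul, Matrix.trace_smul, smul_eq_mul, mul_comm]

/-! ### An informationally complete measurement. -/

/-- An informationally complete measurement: a positive operator-valued measure `E` with Hermitian
reconstruction operators `D`, so that `A = ∑ x, tr (E x * A) • D x` for every `A`. -/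
theorem exists_informationallyComplete (d : Type*) [Fintype d] [DecidableEq d] :
    ∃ (E D : d × d × Fin 4 → Matrix d d ℂ), (∀ x, (E x).PosSemidef) ∧ ∑ x, E x = 1 ∧
      (∀ i j, ∑ x, D x i j • E x = Matrix.single j i 1) ∧ (∀ x, (D x).IsHermitian) ∧
      ∀ x i j, ‖D x i j‖ ≤ 2 * Fintype.card d := by
  -- Polarization by fourth roots of unity: the vectors are `e_a + i^k e_b`, and summing over `k`
  -- keeps only the terms in which the powers of `ω` cancel.
  let ω : Fin 4 → ℂ := fun k => Complex.I ^ (k : ℕ)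
  let v : d × d × Fin 4 → d → ℂ := fun x => Pi.single x.1 1 + ω x.2.2 • Pi.single x.2.1 1
  -- The sum over `k` gives a factor `4`, and the pairs `(a, b)` hit each diagonal entry `2 * card
  -- d` times.
  let E : d × d × Fin 4 → Matrix d d ℂ := fun x =>
    ((8 * Fintype.card d : ℝ)⁻¹ : ℝ) • vecMulVec (v x) (star (v x))
  let D : d × d × Fin 4 → Matrix d d ℂ := fun x =>
    (Fintype.card d : ℂ) • (ω x.2.2 • Matrix.single x.2.1 x.1 1 +
      star (ω x.2.2) • Matrix.single x.1 x.2.1 1)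
  have hω : ∀ k, star (ω k) = (-Complex.I) ^ (k : ℕ) := fun k => by simp [ω]
  have hEapp : ∀ a b k i j, E (a, b, k) i j = (8 * Fintype.card d : ℂ)⁻¹ *
      (((if i = a then 1 else 0) + ω k * (if i = b then 1 else 0)) *
      ((if j = a then 1 else 0) + star (ω k) * (if j = b then 1 else 0))) := by
    intro a b k i j
    simp [E, v, vecMulVec_apply, Pi.single_apply]
  have hDapp : ∀ a b k i j, D (a, b, k) i j = (Fintype.card d : ℂ) *
      (ω k * ((if i = b then 1 else 0) * (if j = a then 1 else 0)) +
      star (ω k) * ((if i = a then 1 else 0) * (if j = b then 1 else 0))) := by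
    intro a b k i j
    simp [D, Matrix.single_apply, ite_and, eq_comm]
    split_ifs <;> ring
  have hsum1 : ∀ a b a' b' : ℂ, ∑ k, (a + ω k * b) * (a' + star (ω k) * b') =
      4 * (a * a' + b * b') := by
    intro a b a' b'
    simp only [hω, ω, Fin.sum_univ_four]
    simp [pow_succ]
    ring_nf
    simp
    ring
  have hsum2 : ∀ e f a b a' b' : ℂ, ∑ k, (ω k * e + star (ω k) * f) *
      ((a + ω k * b) * (a' + star (ω k) * b')) = 4 * (e * (a * b') + f * (b * a')) := by
    intro e f a b a' b'
    simp only [hω, ω, Fin.sum_univ_four]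
    simp [pow_succ]
    ring_nf
    simp
    ring
  refine ⟨E, D, fun x => ?_, ?_, fun i j => ?_, fun x => ?_, fun x i j => ?_⟩
  · exact (posSemidef_vecMulVec_self_star (v x)).smul (by positivity)
  · ext i j
    have : Nonempty d := ⟨i⟩
    have hc : (Fintype.card d : ℂ) ≠ 0 := by simp
    have : ∀ a b, ∑ q, (8 * Fintype.card d : ℂ)⁻¹ *
        (((if i = a then 1 else 0) + ω q * (if i = b then 1 else 0)) *
          ((if j = a then 1 else 0) + star (ω q) * (if j = b then 1 else 0))) =
        (8 * Fintype.card d : ℂ)⁻¹ * (4 * ((if i = a then 1 else 0) * (if j = a then 1 else 0) +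
          (if i = b then 1 else 0) * (if j = b then 1 else 0))) := by
      intro a b
      rw [← Finset.mul_sum, hsum1]
    simp only [Matrix.sum_apply, Fintype.sum_prod_type, hEapp, this]
    simp only [← Finset.mul_sum]
    simp [Finset.sum_add_distrib, Matrix.one_apply, eq_comm]
    split_ifs
    · field_simp
      norm_num
    · simp
  · ext k l
    have : Nonempty d := ⟨i⟩
    have hc : (Fintype.card d : ℂ) ≠ 0 := by simp
    simp only [Matrix.sum_apply, Matrix.smul_apply, smul_eq_mul, Fintype.sum_prod_type, hEapp,
      hDapp]
    -- The two terms survive at `(a, b) = (j, i)` and at `(i, j)`; each supplies half of the matrix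
    -- unit.
    have : ∀ a b, ∑ q, (Fintype.card d : ℂ) *
        (ω q * ((if i = b then 1 else 0) * (if j = a then 1 else 0)) +
          star (ω q) * ((if i = a then 1 else 0) * (if j = b then 1 else 0))) *
        ((8 * Fintype.card d : ℂ)⁻¹ * (((if k = a then 1 else 0) + ω q * (if k = b then 1 else 0)) *
          ((if l = a then 1 else 0) + star (ω q) * (if l = b then 1 else 0)))) =
        1 / 2 * (((if i = b then 1 else 0) * (if j = a then 1 else 0)) *
            ((if k = a then 1 else 0) * (if l = b then 1 else 0)) +
          ((if i = a then 1 else 0) * (if j = b then 1 else 0)) *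
            ((if k = b then 1 else 0) * (if l = a then 1 else 0))) := by
      intro a b
      simp_rw [mul_mul_mul_comm (Fintype.card d : ℂ), ← Finset.mul_sum, hsum2]
      field_simp
      ring
    simp only [this, ← Finset.mul_sum, Finset.sum_add_distrib]
    simp [Matrix.single_apply, ite_and, eq_comm]
    split_ifs <;> norm_num
  · ext i j
    obtain ⟨a, b, k⟩ := x
    simp only [conjTranspose_apply, hDapp]
    simp [apply_ite (starRingEnd ℂ)]
    left
    split_ifs <;> ring
  · obtain ⟨a, b, k⟩ := x
    have hn : ‖ω k‖ = 1 := by simp [ω]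
    rw [hDapp, norm_mul, mul_comm]
    refine mul_le_mul (le_trans (norm_add_le _ _) ?_) (by simp) (by positivity) (by norm_num)
    rw [norm_mul, norm_mul (star _), norm_star, hn]
    have : ∀ p q : Prop, [Decidable p] → [Decidable q] →
        ‖(if p then (1 : ℂ) else 0) * (if q then 1 else 0)‖ ≤ 1 := by
      intro p q _ _
      split_ifs <;> simp
    linarith [this (i = b) (j = a), this (i = a) (j = b)]

end QDeFinetti

/-! ### Counting non-injective maps. -/

open Filter Topology

/-- For fixed `n`, most maps `Fin n → Fin N` are injective when `N` is large. -/
theorem tendsto_card_not_injective_div_pow (n : ℕ) :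
    Tendsto (fun N : ℕ => ((Finset.univ.filter fun i : Fin n → Fin N =>
      ¬ Function.Injective i).card : ℝ) / (N : ℝ) ^ n) atTop (𝓝 0) := by
  have hcard : ∀ N : ℕ, ((Finset.univ.filter fun i : Fin n → Fin N =>
      ¬ Function.Injective i).card : ℝ) = (N : ℝ) ^ n - N.descFactorial n := by
    intro N
    have h1 : (Finset.univ.filter fun i : Fin n → Fin N => Function.Injective i).card =
        N.descFactorial n := by
      rw [← Fintype.card_subtype,
        Fintype.card_congr (Equiv.subtypeInjectiveEquivEmbedding (Fin n) (Fin N)),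
        Fintype.card_embedding_eq, Fintype.card_fin, Fintype.card_fin]
    have h2 := Finset.card_filter_add_card_filter_not (s := Finset.univ)
      (fun i : Fin n → Fin N => Function.Injective i)
    rw [h1, Finset.card_univ, Fintype.card_fun, Fintype.card_fin, Fintype.card_fin] at h2
    have h3 : (N : ℝ) ^ n = N.descFactorial n + ((Finset.univ.filter fun i : Fin n → Fin N =>
      ¬ Function.Injective i).card : ℝ) := by exact_mod_cast h2.symm
    rw [h3]; ring
  -- The fraction of injective maps is the product of the `n` factors `(N - i) / N`, each tending to
  -- `1`.
  have hfac : ∀ i : ℕ, Tendsto (fun N : ℕ => ((N - i : ℕ) : ℝ) / N) atTop (𝓝 1) := by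
    intro i
    have h : Tendsto (fun N : ℕ => 1 - (i : ℝ) / N) atTop (𝓝 (1 - 0)) :=
      tendsto_const_nhds.sub (tendsto_const_div_atTop_nhds_zero_nat _)
    rw [sub_zero] at h
    refine h.congr' ?_
    filter_upwards [eventually_ge_atTop (i + 1)] with N hN
    have : (N : ℝ) ≠ 0 := by norm_cast; omega
    rw [Nat.cast_sub (by omega)]
    field_simp
  have hprod := tendsto_finsetProd (Finset.range n) fun i _ => hfac i
  have h : Tendsto (fun N : ℕ => 1 - ∏ i ∈ Finset.range n, ((N - i : ℕ) : ℝ) / N) atTop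
      (𝓝 (1 - ∏ i ∈ Finset.range n, 1)) := tendsto_const_nhds.sub hprod
  rw [Finset.prod_const_one, sub_self] at h
  refine h.congr' ?_
  filter_upwards [eventually_ge_atTop 1] with N hN
  have : (N : ℝ) ≠ 0 := by norm_cast; omega
  rw [hcard, Finset.prod_div_distrib, Finset.prod_const, Finset.card_range, sub_div,
    div_self (by positivity), Nat.descFactorial_eq_prod_range, Nat.cast_prod]

/-! ### Empirical means and their weak limit. -/

namespace QDeFinetti

variable {d : Type*} [Fintype d] [DecidableEq d] {n : ℕ} {ρ : ∀ n : ℕ, TrialOp d n}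

/-- The compact space of Hermitian matrices with entries bounded by `C`. -/
def HermitianBox (d : Type*) (C : ℝ) : Type _ :=
  {A : Matrix d d ℂ // A.IsHermitian ∧ ∀ i j, ‖A i j‖ ≤ C}

instance (C : ℝ) : TopologicalSpace (HermitianBox d C) :=
  inferInstanceAs (TopologicalSpace {A : Matrix d d ℂ // A.IsHermitian ∧ ∀ i j, ‖A i j‖ ≤ C})

instance (C : ℝ) : MeasurableSpace (HermitianBox d C) := borel _

instance (C : ℝ) : BorelSpace (HermitianBox d C) := ⟨rfl⟩

instance (C : ℝ) : T2Space (HermitianBox d C) :=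
  inferInstanceAs (T2Space {A : Matrix d d ℂ // A.IsHermitian ∧ ∀ i j, ‖A i j‖ ≤ C})

instance (C : ℝ) : CompactSpace (HermitianBox d C) := by
  refine isCompact_iff_compactSpace.mp ?_
  have hcomp : IsCompact {A : d → d → ℂ | ∀ i j, ‖A i j‖ ≤ C} := by
    have h : IsCompact (Set.univ.pi fun _ : d => Set.univ.pi fun _ : d =>
        Metric.closedBall (0 : ℂ) C) :=
      isCompact_univ_pi fun _ => isCompact_univ_pi fun _ => isCompact_closedBall 0 C
    convert h using 1
    ext A
    simp
  have hclosed : IsClosed {A : Matrix d d ℂ | A.IsHermitian} :=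
    isClosed_eq (continuous_id.matrix_conjTranspose) continuous_id
  exact IsCompact.inter_left (X := Matrix d d ℂ) hcomp hclosed

omit [Fintype d] [DecidableEq d] in
theorem HermitianBox.continuous_val (C : ℝ) :
    Continuous fun σ : HermitianBox d C => σ.1 := continuous_subtype_val

omit [Fintype d] [DecidableEq d] in
theorem continuous_tensorPower_apply (μ ν : Fin n → d) :
    Continuous fun σ : Matrix d d ℂ => tensorPower σ n μ ν := by
  simp only [tensorPower, Matrix.of_apply]
  fun_prop

/-- The empirical mean of the matrices `D (x k)` over the trials `k`. -/
noncomputable def empiricalMean {X : Type*} (D : X → Matrix d d ℂ) {N : ℕ} (x : Fin N → X) :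
    Matrix d d ℂ :=
  (N : ℝ)⁻¹ • ∑ k, D (x k)

section

variable {X : Type*} [Fintype X] {E D : X → Matrix d d ℂ} {C : ℝ} {N : ℕ}

omit [Fintype d] [DecidableEq d] [Fintype X] in
theorem empiricalMean_mem (hC : 0 ≤ C) (hDh : ∀ x, (D x).IsHermitian)
    (hDC : ∀ x i j, ‖D x i j‖ ≤ C) (x : Fin N → X) :
    (empiricalMean D x).IsHermitian ∧ ∀ i j, ‖empiricalMean D x i j‖ ≤ C := by
  refine ⟨?_, fun i j => ?_⟩
  · have h : (∑ k, D (x k)).IsHermitian := by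
      rw [Matrix.IsHermitian, Matrix.conjTranspose_sum]
      exact Finset.sum_congr rfl fun k _ => hDh _
    rw [Matrix.IsHermitian, empiricalMean, Matrix.conjTranspose_smul, h.eq, star_trivial]
  · rw [empiricalMean, Matrix.smul_apply, Matrix.sum_apply, norm_smul, norm_inv, Real.norm_natCast]
    have h : ‖∑ k, D (x k) i j‖ ≤ N * C := by
      simpa using norm_sum_le_of_le Finset.univ (fun k _ => hDC (x k) i j)
    rcases Nat.eq_zero_or_pos N with rfl | hN
    · simpa using hC
    · rw [inv_mul_le_iff₀ (by positivity)]
      exact h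

-- These traces are the joint outcome probabilities when `E` is measured in each of `N` trials.
omit [Fintype X] in
theorem IsExchangeable.trace_mul_tensorProd_nonneg (hρ : IsExchangeable ρ) (hN : 1 ≤ N)
    (hEp : ∀ x, (E x).PosSemidef) (x : Fin N → X) :
    0 ≤ (ρ N * tensorProd fun k => E (x k)).trace :=
  (hρ.isState N hN).1.trace_mul_nonneg (posSemidef_tensorProd fun _ => hEp _)

theorem IsExchangeable.sum_trace_mul_tensorProd (hρ : IsExchangeable ρ) (hN : 1 ≤ N)
    (hE : ∑ x, E x = 1) :
    ∑ x : Fin N → X, (ρ N * tensorProd fun k => E (x k)).trace = 1 := by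
  have h := tensorProd_sum (n := N) E fun _ _ => 1
  simp only [one_smul, hE, Finset.prod_const_one, tensorProd_one] at h
  rw [← Matrix.trace_sum, ← Matrix.mul_sum, ← h, Matrix.mul_one, (hρ.isState N hN).2]

/-- The average of the tensor power of the empirical mean is, up to the repeated trials, the
state `ρ n`. -/
theorem IsExchangeable.tendsto_sum_trace_mul_empiricalMean (hρ : IsExchangeable ρ) (hn : 1 ≤ n)
    (hEp : ∀ x, (E x).PosSemidef) (hE : ∑ x, E x = 1)
    (hD : ∀ i j, ∑ x, D x i j • E x = Matrix.single j i 1)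
    (hDC : ∀ x i j, ‖D x i j‖ ≤ C) (μ ν : Fin n → d) :
    Tendsto (fun N : ℕ => ∑ x : Fin N → X, (ρ N * tensorProd fun k => E (x k)).trace *
      tensorPower (empiricalMean D x) n μ ν) atTop (𝓝 (ρ n μ ν)) := by
  -- `p N x` is the probability of the outcome word `x`, and `S N i` the mean of the product of the
  -- estimates read off at the trials `i`.
  let p : ∀ N : ℕ, (Fin N → X) → ℂ := fun N x => (ρ N * tensorProd fun k => E (x k)).trace
  let S : ∀ N : ℕ, (Fin n → Fin N) → ℂ := fun N i =>
    ∑ x : Fin N → X, p N x * ∏ l, D (x (i l)) (μ l) (ν l)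
  have hexp : ∀ N : ℕ, ∑ x : Fin N → X, p N x * tensorPower (empiricalMean D x) n μ ν =
      ((N : ℂ) ^ n)⁻¹ * ∑ i : Fin n → Fin N, S N i := by
    intro N
    simp only [S]
    rw [Finset.sum_comm, Finset.mul_sum]
    refine Finset.sum_congr rfl fun x _ => ?_
    rw [← Finset.mul_sum, mul_left_comm]
    congr 1
    simp only [tensorPower, Matrix.of_apply, empiricalMean, Matrix.smul_apply, Matrix.sum_apply]
    simp only [Complex.real_smul, Finset.prod_mul_distrib, Finset.prod_univ_sum,
      Fintype.piFinset_univ]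
    simp
  have hSbound : ∀ N, 1 ≤ N → ∀ i, ‖S N i‖ ≤ C ^ n := by
    intro N hN i
    have hp : ∀ x, ‖p N x‖ = (p N x).re := fun x =>
      congrArg Complex.re (Complex.norm_of_nonneg' (hρ.trace_mul_tensorProd_nonneg hN hEp x))
    have hp1 : ∑ x, ‖p N x‖ = 1 := by
      simp_rw [hp]
      rw [← Complex.re_sum, hρ.sum_trace_mul_tensorProd hN hE, Complex.one_re]
    calc ‖S N i‖ ≤ ∑ x, ‖p N x‖ * C ^ n := by
          refine norm_sum_le_of_le _ fun x _ => ?_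
          rw [norm_mul, norm_prod]
          refine mul_le_mul_of_nonneg_left ?_ (norm_nonneg _)
          calc ∏ l, ‖D (x (i l)) (μ l) (ν l)‖ ≤ ∏ _l : Fin n, C :=
                Finset.prod_le_prod (fun _ _ => norm_nonneg _) fun l _ => hDC _ _ _
            _ = C ^ n := by simp
      _ = C ^ n := by rw [← Finset.sum_mul, hp1, one_mul]
  rw [tendsto_iff_norm_sub_tendsto_zero]
  have hlim := (tendsto_card_not_injective_div_pow n).mul_const (C ^ n + ‖ρ n μ ν‖)
  rw [zero_mul] at hlim
  refine squeeze_zero' (Eventually.of_forall fun _ => norm_nonneg _) ?_ hlim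
  filter_upwards [eventually_ge_atTop 1] with N hN
  have hN0 : (N : ℂ) ≠ 0 := by norm_cast; omega
  have hsub : ((N : ℂ) ^ n)⁻¹ * ∑ i : Fin n → Fin N, S N i - ρ n μ ν =
      ((N : ℂ) ^ n)⁻¹ * ∑ i : Fin n → Fin N, (S N i - ρ n μ ν) := by
    rw [Finset.sum_sub_distrib, mul_sub]
    simp [hN0]
  change ‖∑ x : Fin N → X, p N x * _ - _‖ ≤ _
  rw [hexp N, hsub, norm_mul, norm_inv, norm_pow, Complex.norm_natCast, inv_mul_eq_div,
    div_mul_eq_mul_div]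
  refine div_le_div_of_nonneg_right ?_ (by positivity)
  rw [← Finset.sum_filter_of_ne (p := fun i : Fin n → Fin N => ¬ Function.Injective i)]
  · calc _ ≤ ∑ i : Fin n → Fin N with ¬ Function.Injective i, (C ^ n + ‖ρ n μ ν‖) :=
          norm_sum_le_of_le _ fun i _ =>
            (norm_sub_le _ _).trans (add_le_add_left (hSbound N hN i) _)
      _ = _ := by rw [Finset.sum_const, nsmul_eq_mul]
  · intro i _ hi hinj
    exact hi (sub_eq_zero.mpr (hρ.sum_trace_mul_prod hn hE hD ⟨i, hinj⟩ μ ν))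

end

/-- An exchangeable sequence of states is a mixture of tensor powers of Hermitian matrices. -/
theorem IsExchangeable.exists_measure_hermitianBox (hρ : IsExchangeable ρ) :
    ∃ (C : ℝ) (P : Measure (HermitianBox d C)), 1 ≤ C ∧ IsProbabilityMeasure P ∧
      ∀ n, 1 ≤ n → ∀ μ ν : Fin n → d, ρ n μ ν = ∫ σ, tensorPower σ.1 n μ ν ∂P := by
  obtain ⟨E, D, hEp, hE, hD, hDh, hDC⟩ := exists_informationallyComplete d
  have : Nonempty d := by
    by_contra h
    rw [not_nonempty_iff] at h
    simpa [Matrix.trace] using (hρ.isState 1 le_rfl).2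
  have hcard : (1 : ℝ) ≤ Fintype.card d := by exact_mod_cast Fintype.card_pos
  set C : ℝ := 2 * Fintype.card d with hC
  let est : ∀ N : ℕ, (Fin N → d × d × Fin 4) → HermitianBox d C := fun N x =>
    ⟨empiricalMean D x, empiricalMean_mem (by positivity) hDh hDC x⟩
  let p : ∀ N : ℕ, (Fin N → d × d × Fin 4) → ℂ := fun N x =>
    (ρ N * tensorProd fun k => E (x k)).trace
  have hp : ∀ N x, 0 ≤ p (N + 1) x := fun N x =>
    hρ.trace_mul_tensorProd_nonneg (Nat.le_add_left 1 N) hEp x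
  -- Shifted by one, because `ρ 0` is unconstrained.
  let Q : ℕ → Measure (HermitianBox d C) := fun N =>
    ∑ x, ENNReal.ofReal (p (N + 1) x).re • Measure.dirac (est (N + 1) x)
  have hQ : ∀ N, IsProbabilityMeasure (Q N) := by
    intro N
    refine ⟨?_⟩
    simp only [Q, Measure.finsetSum_apply, Measure.smul_apply, measure_univ, smul_eq_mul, mul_one]
    rw [← ENNReal.ofReal_sum_of_nonneg fun x _ => (Complex.nonneg_iff.mp (hp N x)).1,
      ← Complex.re_sum, hρ.sum_trace_mul_tensorProd (Nat.le_add_left 1 N) hE]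
    simp
  let Q' : ℕ → ProbabilityMeasure (HermitianBox d C) := fun N => ⟨Q N, hQ N⟩
  -- Compactness yields a limit along a nonprincipal ultrafilter; the moments converge along
  -- `atTop`, hence along this finer filter.
  obtain ⟨P, -, hP⟩ :=
    (isCompact_univ (X := ProbabilityMeasure (HermitianBox d C))).ultrafilter_le_nhds
      ((hyperfilter ℕ).map Q') (by simp)
  have hP' : Tendsto Q' (hyperfilter ℕ) (𝓝 P) := hP
  rw [ProbabilityMeasure.tendsto_iff_forall_integral_rclike_tendsto ℂ] at hP'
  refine ⟨C, P, by linarith, inferInstance, fun n hn μ ν => ?_⟩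
  have h1 := hP' (BoundedContinuousFunction.mkOfCompact
    ⟨fun σ : HermitianBox d C => tensorPower σ.1 n μ ν,
      (continuous_tensorPower_apply μ ν).comp (HermitianBox.continuous_val C)⟩)
  have h2 := ((tendsto_add_atTop_iff_nat 1).mpr
    (hρ.tendsto_sum_trace_mul_empiricalMean hn hEp hE hD hDC μ ν)).mono_left
      (Nat.hyperfilter_le_atTop)
  refine tendsto_nhds_unique h2 (h1.congr fun N => ?_)
  change ∫ σ, tensorPower σ.1 n μ ν ∂(Q N) = _
  rw [integral_finsetSum_measure]
  · refine Finset.sum_congr rfl fun x _ => ?_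
    rw [integral_smul_measure, integral_dirac,
      ENNReal.toReal_ofReal (Complex.nonneg_iff.mp (hp N x)).1, Complex.real_smul,
      ← Complex.eq_re_of_ofReal_le (r := 0) (by simpa using hp N x)]
  · intro x _
    refine Integrable.smul_measure ?_ ENNReal.ofReal_ne_top
    exact integrable_dirac (by simp)

end QDeFinetti

/-! ### Concentration on states, from moments. -/

/-- A random variable whose even moments are all at most `1` is bounded by `1`. -/
theorem MeasureTheory.ae_abs_le_one_of_integral_pow_le_one {Ω : Type*} [MeasurableSpace Ω]
    {P : Measure Ω} [IsFiniteMeasure P] {X : Ω → ℝ}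
    (hint : ∀ n : ℕ, 1 ≤ n → Integrable (fun ω => X ω ^ (2 * n)) P)
    (hmom : ∀ n : ℕ, 1 ≤ n → ∫ ω, X ω ^ (2 * n) ∂P ≤ 1) : ∀ᵐ ω ∂P, |X ω| ≤ 1 := by
  have hlevel : ∀ k : ℕ, ∀ᵐ ω ∂P, |X ω| < 1 + 1 / ((k : ℝ) + 1) := by
    intro k
    set b : ℝ := 1 + 1 / ((k : ℝ) + 1) with hb
    have hb1 : 1 < b := by rw [hb]; linarith [Nat.one_div_pos_of_nat (α := ℝ) (n := k)]
    -- Markov's inequality for `X ^ (2 * n)` at level `b ^ (2 * n)`; the bound decays geometrically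
    -- since `b > 1`.
    have hbound : ∀ n : ℕ, 1 ≤ n → P.real {ω | b ≤ |X ω|} ≤ (b⁻¹ ^ 2) ^ n := by
      intro n hn
      have h := mul_meas_ge_le_integral_of_nonneg
        (Eventually.of_forall fun ω => (even_two_mul n).pow_nonneg (X ω)) (hint n hn) (b ^ (2 * n))
      have hsub : P.real {ω | b ≤ |X ω|} ≤ P.real {ω | b ^ (2 * n) ≤ X ω ^ (2 * n)} := by
        refine measureReal_mono fun ω hω => ?_
        have : b ^ (2 * n) ≤ |X ω| ^ (2 * n) := pow_le_pow_left₀ (by linarith) hω _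
        rwa [(even_two_mul n).pow_abs] at this
      have hpos : 0 < b ^ (2 * n) := by positivity
      rw [← pow_mul, inv_pow, ← one_div, le_div_iff₀ hpos, mul_comm]
      exact ((mul_le_mul_of_nonneg_left hsub hpos.le).trans h).trans (hmom n hn)
    have hlim : Tendsto (fun n : ℕ => (b⁻¹ ^ 2) ^ n) atTop (𝓝 0) :=
      tendsto_pow_atTop_nhds_zero_of_lt_one (by positivity)
        (pow_lt_one₀ (by positivity) (inv_lt_one_of_one_lt₀ hb1) two_ne_zero)
    have hzero : P.real {ω | b ≤ |X ω|} ≤ 0 :=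
      ge_of_tendsto hlim (eventually_atTop.mpr ⟨1, hbound⟩)
    rw [ae_iff]
    simp only [not_lt]
    exact (measureReal_eq_zero_iff).mp (le_antisymm hzero measureReal_nonneg)
  filter_upwards [ae_all_iff.mpr hlevel] with ω hω
  refine ge_of_tendsto' (f := fun k : ℕ => 1 + 1 / ((k : ℝ) + 1)) (x := atTop) ?_
    fun k => (hω k).le
  simpa using tendsto_const_nhds.add (tendsto_one_div_add_atTop_nhds_zero_nat (𝕜 := ℝ))

theorem Matrix.trace_vecMulVec_star_mul {ι : Type*} [Fintype ι] (v : ι → ℂ) (A : Matrix ι ι ℂ) :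
    (vecMulVec v (star v) * A).trace = star v ⬝ᵥ A *ᵥ v := by
  rw [vecMulVec_mul, trace_vecMulVec, dotProduct_comm, dotProduct_mulVec]

theorem Matrix.IsHermitian.trace_mul_eq_re {ι : Type*} [Fintype ι] {A B : Matrix ι ι ℂ}
    (hA : A.IsHermitian) (hB : B.IsHermitian) : (A * B).trace = ((A * B).trace.re : ℂ) := by
  refine (Complex.conj_eq_iff_re.mp ?_).symm
  rw [starRingEnd_apply, ← trace_conjTranspose, conjTranspose_mul, hA.eq, hB.eq, trace_mul_comm]

namespace QDeFinetti

variable {d : Type*} [Fintype d] [DecidableEq d] {n : ℕ} {ρ : ∀ n : ℕ, TrialOp d n}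

omit [DecidableEq d] in
/-- If `A` is the average of tensor powers, then the moments of the random number `tr (G σ)` are
expectation values in `A`. -/
theorem integral_trace_mul_pow {Ω : Type*} [MeasurableSpace Ω] {P : Measure Ω}
    {s : Ω → Matrix d d ℂ} {A : TrialOp d n}
    (hint : ∀ μ ν, Integrable (fun ω => tensorPower (s ω) n μ ν) P)
    (hrep : ∀ μ ν, A μ ν = ∫ ω, tensorPower (s ω) n μ ν ∂P) (G : Matrix d d ℂ) :
    ∫ ω, (G * s ω).trace ^ n ∂P = (A * tensorPower G n).trace := by
  -- The trace of a tensor power is the power of the trace.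
  have hpow : ∀ ω, (G * s ω).trace ^ n =
      ∑ μ, ∑ ν, tensorPower (s ω) n μ ν * tensorPower G n ν μ := by
    intro ω
    have h := trace_tensorProd fun _ : Fin n => s ω * G
    rw [Finset.prod_const, Finset.card_univ, Fintype.card_fin, ← tensorProd_mul] at h
    rw [trace_mul_comm, ← h]
    rfl
  simp_rw [hpow]
  rw [integral_finsetSum _ fun μ _ => integrable_finsetSum _ fun ν _ => (hint μ ν).mul_const _]
  refine Finset.sum_congr rfl fun μ _ => ?_
  rw [integral_finsetSum _ fun ν _ => (hint μ ν).mul_const _, Matrix.diag, Matrix.mul_apply]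
  refine Finset.sum_congr rfl fun ν _ => ?_
  rw [integral_mul_const, hrep]

section HermitianBox

variable {C : ℝ} {P : Measure (HermitianBox d C)} [IsProbabilityMeasure P]

omit [Fintype d] [DecidableEq d] in
theorem HermitianBox.integrable_of_continuous {F : Type*} [NormedAddCommGroup F]
    {f : HermitianBox d C → F} (hf : Continuous f) : Integrable f P :=
  hf.integrable_of_hasCompactSupport (HasCompactSupport.of_compactSpace f)

omit [DecidableEq d] in
theorem HermitianBox.continuous_trace_mul (E : Matrix d d ℂ) :
    Continuous fun σ : HermitianBox d C => (E * σ.1).trace :=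
  (continuous_const.matrix_mul (HermitianBox.continuous_val C)).matrix_trace

variable (hρ : IsExchangeable ρ)
  (hP : ∀ n, 1 ≤ n → ∀ μ ν : Fin n → d, ρ n μ ν = ∫ σ, tensorPower σ.1 n μ ν ∂P)

include hρ hP

/-- The `2n`-th moment of `tr (E σ)` is the probability of obtaining `E` in all of `2n` trials. Even
moments are used because the sign of `tr (E σ)` is not yet known. -/
theorem IsExchangeable.ae_abs_trace_mul_le_one {E : Matrix d d ℂ} (hE : IsEffect E) :
    ∀ᵐ σ ∂P, |(E * σ.1).trace.re| ≤ 1 := by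
  have hcont : Continuous fun σ : HermitianBox d C => (E * σ.1).trace.re :=
    Complex.continuous_re.comp (HermitianBox.continuous_trace_mul E)
  refine ae_abs_le_one_of_integral_pow_le_one
    (fun n _ => HermitianBox.integrable_of_continuous (hcont.pow _)) fun n hn => ?_
  have h := integral_trace_mul_pow (n := 2 * n) (fun μ ν =>
    HermitianBox.integrable_of_continuous
      ((continuous_tensorPower_apply μ ν).comp (HermitianBox.continuous_val C)))
    (hP (2 * n) (by omega)) E
  have h1 := ((hρ.isState (2 * n) (by omega)).trace_mul_tensorPower_mem hE).2
  rw [← h] at h1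
  have h2 : ∀ σ : HermitianBox d C,
      (E * σ.1).trace ^ (2 * n) = (((E * σ.1).trace.re ^ (2 * n) : ℝ) : ℂ) := by
    intro σ
    rw [Complex.ofReal_pow, ← hE.1.isHermitian.trace_mul_eq_re σ.2.1]
  simp_rw [h2] at h1
  rw [integral_complex_ofReal] at h1
  exact_mod_cast h1

/-- The effect `1` gives `tr σ ≤ 1` almost surely, while the mean of `tr σ` is the trace of `ρ 1`,
which is one. -/
theorem IsExchangeable.ae_trace_eq_one : ∀ᵐ σ ∂P, σ.1.trace = 1 := by
  have hone : IsEffect (1 : Matrix d d ℂ) :=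
    ⟨PosSemidef.one, by rw [sub_self]; exact PosSemidef.zero⟩
  have hre : ∀ σ : HermitianBox d C, σ.1.trace = (σ.1.trace.re : ℂ) := fun σ => by
    simpa using PosSemidef.one.isHermitian.trace_mul_eq_re (A := (1 : Matrix d d ℂ)) σ.2.1
  have hle : ∀ᵐ σ ∂P, 0 ≤ 1 - σ.1.trace.re := by
    filter_upwards [hρ.ae_abs_trace_mul_le_one hP hone] with σ hσ
    rw [Matrix.one_mul] at hσ
    linarith [(abs_le.mp hσ).2]
  have hint : Integrable (fun σ : HermitianBox d C => σ.1.trace.re) P :=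
    HermitianBox.integrable_of_continuous
      (Complex.continuous_re.comp (HermitianBox.continuous_val C).matrix_trace)
  have h := integral_trace_mul_pow (n := 1) (fun μ ν =>
    HermitianBox.integrable_of_continuous
      ((continuous_tensorPower_apply μ ν).comp (HermitianBox.continuous_val C)))
    (hP 1 le_rfl) 1
  rw [← tensorProd_const, tensorProd_one, Matrix.mul_one, (hρ.isState 1 le_rfl).2] at h
  simp only [Matrix.one_mul, pow_one] at h
  rw [integral_congr_ae (ae_of_all _ hre), integral_complex_ofReal] at h
  have h0 : ∫ σ, (1 - σ.1.trace.re) ∂P = 0 := by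
    rw [integral_sub (integrable_const _) hint, (by exact_mod_cast h : ∫ σ, σ.1.trace.re ∂P = 1)]
    simp
  filter_upwards [(integral_eq_zero_iff_of_nonneg_ae hle ((integrable_const _).sub hint)).mp h0]
    with σ hσ
  have h3 : 1 - σ.1.trace.re = 0 := hσ
  rw [hre, show σ.1.trace.re = 1 by linarith, Complex.ofReal_one]

/-- Scale the rank-one operator of `v` to an effect. Its complement has expectation at most one,
which, as `tr σ = 1`, is a lower bound for the effect itself. -/
theorem IsExchangeable.ae_dotProduct_mulVec_nonneg (v : d → ℂ) :
    ∀ᵐ σ ∂P, 0 ≤ (star v ⬝ᵥ σ.1 *ᵥ v).re := by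
  obtain ⟨c, hc, hcA⟩ := (posSemidef_vecMulVec_self_star v).exists_smul_one_sub
  set A := vecMulVec v (star v)
  have hE : IsEffect (((c⁻¹ : ℝ) : ℂ) • A) := by
    refine ⟨(posSemidef_vecMulVec_self_star v).smul (by positivity), ?_⟩
    have h : 1 - ((c⁻¹ : ℝ) : ℂ) • A = ((c⁻¹ : ℝ) : ℂ) • ((c : ℂ) • (1 : Matrix d d ℂ) - A) := by
      rw [smul_sub, smul_smul, ← Complex.ofReal_mul, inv_mul_cancel₀ hc.ne', Complex.ofReal_one,
        one_smul]
    rw [h]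
    exact hcA.smul (by positivity)
  have hE' : IsEffect (1 - ((c⁻¹ : ℝ) : ℂ) • A) := ⟨hE.2, by rw [sub_sub_cancel]; exact hE.1⟩
  filter_upwards [hρ.ae_abs_trace_mul_le_one hP hE', hρ.ae_trace_eq_one hP] with σ h1 h2
  rw [Matrix.sub_mul, Matrix.one_mul, Matrix.trace_sub, h2, Matrix.smul_mul, Matrix.trace_smul,
    trace_vecMulVec_star_mul, Complex.sub_re, Complex.one_re, smul_eq_mul, Complex.re_ofReal_mul]
    at h1
  have h3 : 0 ≤ c⁻¹ * (star v ⬝ᵥ σ.1 *ᵥ v).re := by linarith [(abs_le.mp h1).2]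
  exact nonneg_of_mul_nonneg_right h3 (inv_pos.mpr hc)

/-- The exceptional null set depends on `v`, so positivity is imposed on a countable dense set of
vectors and extended by continuity. -/
theorem IsExchangeable.ae_isState : ∀ᵐ σ ∂P, IsState σ.1 := by
  have hdense : ∀ᵐ σ ∂P, ∀ k : ℕ, 0 ≤ (star (TopologicalSpace.denseSeq (d → ℂ) k) ⬝ᵥ
      σ.1 *ᵥ TopologicalSpace.denseSeq (d → ℂ) k).re :=
    ae_all_iff.mpr fun k => hρ.ae_dotProduct_mulVec_nonneg hP _
  filter_upwards [hdense, hρ.ae_trace_eq_one hP] with σ h1 h2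
  refine ⟨PosSemidef.of_dotProduct_mulVec_nonneg σ.2.1 fun v => ?_, h2⟩
  refine Complex.nonneg_iff.mpr ⟨?_, (σ.2.1.im_star_dotProduct_mulVec_self v).symm⟩
  refine (TopologicalSpace.denseRange_denseSeq (d → ℂ)).induction_on (p := fun v =>
    0 ≤ (star v ⬝ᵥ σ.1 *ᵥ v).re) v ?_ h1
  refine isClosed_le continuous_const (Complex.continuous_re.comp ?_)
  exact continuous_star.dotProduct (continuous_const.matrix_mulVec continuous_id)

end HermitianBox

/-! ### The state space: existence and uniqueness of the de Finetti measure. -/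

section StateSpace

omit [DecidableEq d] in
theorem isClosed_setOf_isState : IsClosed {A : Matrix d d ℂ | IsState A} := by
  have h : {A : Matrix d d ℂ | IsState A} = {A : Matrix d d ℂ | A.IsHermitian} ∩
      (⋂ v : d → ℂ, {A : Matrix d d ℂ | 0 ≤ star v ⬝ᵥ A *ᵥ v}) ∩
      {A : Matrix d d ℂ | A.trace = 1} := by
    ext A
    simp [IsState, posSemidef_iff_dotProduct_mulVec]
  rw [h]
  refine ((isClosed_eq continuous_id.matrix_conjTranspose continuous_id).inter
    (isClosed_iInter fun v => ?_)).inter (isClosed_eq continuous_id.matrix_trace continuous_const)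
  exact isClosed_le continuous_const
    (continuous_const.dotProduct (continuous_id.matrix_mulVec continuous_const))

/-- The entries of a density operator are bounded by `1`. -/
theorem IsState.norm_apply_le_one {A : Matrix d d ℂ} (hA : IsState A) (i j : d) :
    ‖A i j‖ ≤ 1 := by
  obtain ⟨B, hB⟩ : ∃ B : Matrix d d ℂ, A = Bᴴ * B := by
    open scoped MatrixOrder in
    exact CStarAlgebra.nonneg_iff_eq_star_mul_self.mp hA.1.nonneg
  have hdiag : ∀ i, A i i = ((∑ k, ‖B k i‖ ^ 2 : ℝ) : ℂ) := by
    intro i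
    rw [hB, Matrix.mul_apply, Complex.ofReal_sum]
    refine Finset.sum_congr rfl fun k _ => ?_
    rw [conjTranspose_apply, Complex.star_def, Complex.conj_mul', Complex.ofReal_pow]
  have htr : ∑ i, ∑ k, ‖B k i‖ ^ 2 = 1 := by
    have h := hA.2
    simp only [Matrix.trace, Matrix.diag, hdiag] at h
    exact_mod_cast h
  have hle : ∀ i, ∑ k, ‖B k i‖ ^ 2 ≤ 1 := fun i => htr ▸
    Finset.single_le_sum (f := fun i => ∑ k, ‖B k i‖ ^ 2)
      (fun i _ => Finset.sum_nonneg fun k _ => by positivity) (Finset.mem_univ i)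
  calc ‖A i j‖ ≤ ∑ k, (‖B k i‖ ^ 2 + ‖B k j‖ ^ 2) / 2 := by
        rw [hB, Matrix.mul_apply]
        refine norm_sum_le_of_le _ fun k _ => ?_
        rw [norm_mul, conjTranspose_apply, norm_star]
        linarith [two_mul_le_add_sq ‖B k i‖ ‖B k j‖]
    _ ≤ 1 := by
        rw [← Finset.sum_div, Finset.sum_add_distrib]
        linarith [hle i, hle j]

/-- The inclusion of the density operators into a space of bounded Hermitian matrices. -/
def StateSpace.toHermitianBox {C : ℝ} (hC : 1 ≤ C) (σ : StateSpace d) : HermitianBox d C :=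
  ⟨σ.1, σ.2.1.isHermitian, fun i j => (σ.2.norm_apply_le_one i j).trans hC⟩

theorem StateSpace.range_toHermitianBox {C : ℝ} (hC : 1 ≤ C) :
    Set.range (StateSpace.toHermitianBox (d := d) hC) = {σ | IsState σ.1} := by
  ext σ
  refine ⟨?_, fun h => ⟨⟨σ.1, h⟩, rfl⟩⟩
  rintro ⟨τ, rfl⟩
  exact τ.2

/-- Used to pull a measure concentrated on states back to the state space, and to transfer
compactness. -/
theorem StateSpace.isClosedEmbedding_toHermitianBox {C : ℝ} (hC : 1 ≤ C) :
    IsClosedEmbedding (StateSpace.toHermitianBox (d := d) hC) := by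
  refine ⟨?_, ?_⟩
  · have hval : IsEmbedding fun σ : StateSpace d => σ.1 := IsEmbedding.subtypeVal
    have hcont : Continuous (StateSpace.toHermitianBox (d := d) hC) :=
      hval.continuous.subtype_mk _
    exact IsEmbedding.of_comp hcont (HermitianBox.continuous_val C) hval
  · rw [StateSpace.range_toHermitianBox]
    exact isClosed_setOf_isState.preimage (HermitianBox.continuous_val C)

instance : CompactSpace (StateSpace d) :=
  (StateSpace.isClosedEmbedding_toHermitianBox le_rfl).compactSpace

instance : T2Space (StateSpace d) :=
  inferInstanceAs (T2Space {σ : Matrix d d ℂ // IsState σ})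

instance : SecondCountableTopology (StateSpace d) :=
  have : SecondCountableTopology (Matrix d d ℂ) :=
    inferInstanceAs (SecondCountableTopology (d → d → ℂ))
  TopologicalSpace.Subtype.secondCountableTopology {σ : Matrix d d ℂ | IsState σ}

omit [DecidableEq d] in
theorem StateSpace.continuous_val : Continuous fun σ : StateSpace d => σ.1 :=
  continuous_subtype_val

theorem StateSpace.integrable_of_continuous {P : Measure (StateSpace d)} [IsFiniteMeasure P]
    {F : Type*} [NormedAddCommGroup F] {f : StateSpace d → F} (hf : Continuous f) :
    Integrable f P :=
  hf.integrable_of_hasCompactSupport (HasCompactSupport.of_compactSpace f)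

/-- **Quantum de Finetti theorem**, existence of the de Finetti measure. -/
theorem IsExchangeable.exists_isDeFinettiMeasure (hρ : IsExchangeable ρ) :
    ∃ P : Measure (StateSpace d), IsDeFinettiMeasure ρ P := by
  obtain ⟨C, P, hC, hprob, hP⟩ := hρ.exists_measure_hermitianBox
  have hemb := (StateSpace.isClosedEmbedding_toHermitianBox (d := d) hC).measurableEmbedding
  have hae : ∀ᵐ σ ∂P, σ ∈ Set.range (StateSpace.toHermitianBox (d := d) hC) := by
    rw [StateSpace.range_toHermitianBox]
    exact hρ.ae_isState hP
  have hmap : (P.comap (StateSpace.toHermitianBox hC)).map (StateSpace.toHermitianBox hC) = P := by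
    rw [hemb.map_comap, Measure.restrict_eq_self_of_ae_mem hae]
  refine ⟨P.comap (StateSpace.toHermitianBox hC), ⟨?_⟩, fun n hn μ ν => ?_⟩
  · rw [hemb.comap_apply, Set.image_univ, ← Measure.restrict_apply_univ,
      Measure.restrict_eq_self_of_ae_mem hae, measure_univ]
  · rw [hP n hn μ ν]
    conv_lhs => rw [← hmap, hemb.integral_map]
    rfl

/-- A matrix entry as a bounded continuous function of the density operator. -/
noncomputable def entry (i j : d) : BoundedContinuousFunction (StateSpace d) ℂ :=
  BoundedContinuousFunction.mkOfCompact
    ⟨fun σ => σ.1 i j, StateSpace.continuous_val.matrix_elem i j⟩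

theorem entry_apply (i j : d) (σ : StateSpace d) : entry i j σ = σ.1 i j := rfl

theorem star_entry (i j : d) : star (entry i j) = entry j i := by
  ext σ
  exact σ.2.1.isHermitian.apply j i

/-- Concatenating words multiplies the corresponding entries of tensor powers. -/
theorem exists_tensorPower_of_mem_closure {f : BoundedContinuousFunction (StateSpace d) ℂ}
    (hf : f ∈ Submonoid.closure (Set.range fun p : d × d => entry p.1 p.2)) :
    ∃ (n : ℕ) (μ ν : Fin n → d), ∀ σ, f σ = tensorPower σ.1 n μ ν := by
  induction hf using Submonoid.closure_induction with
  | mem f hf =>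
    obtain ⟨p, rfl⟩ := hf
    exact ⟨1, fun _ => p.1, fun _ => p.2, fun σ => by simp [tensorPower, entry_apply]⟩
  | one => exact ⟨0, Fin.elim0, Fin.elim0, fun σ => by simp [tensorPower]⟩
  | mul f g _ _ hf hg =>
    obtain ⟨n, μ, ν, hf⟩ := hf
    obtain ⟨m, μ', ν', hg⟩ := hg
    refine ⟨n + m, Fin.append μ μ', Fin.append ν ν', fun σ => ?_⟩
    simp [tensorPower, Fin.prod_univ_add, hf, hg]

/-- **Quantum de Finetti theorem**, uniqueness of the de Finetti measure. -/
theorem IsDeFinettiMeasure.unique {P Q : Measure (StateSpace d)} (hP : IsDeFinettiMeasure ρ P)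
    (hQ : IsDeFinettiMeasure ρ Q) : P = Q := by
  let := TopologicalSpace.metrizableSpaceMetric (StateSpace d)
  have := hP.isProbability
  have := hQ.isProbability
  set s : Set (BoundedContinuousFunction (StateSpace d) ℂ) :=
    Set.range fun p : d × d => entry p.1 p.2 with hs
  have hstar : star s ⊆ s := by
    rintro f ⟨p, hp⟩
    exact ⟨p.swap, by rw [← star_star f, ← hp]; exact (star_entry p.1 p.2).symm⟩
  refine ext_of_forall_mem_subalgebra_integral_eq_of_pseudoEMetric_complete_countable
    (A := StarAlgebra.adjoin ℂ s) ?_ fun g hg => ?_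
  · intro σ τ hστ
    obtain ⟨i, j, hij⟩ : ∃ i j, σ.1 i j ≠ τ.1 i j := by
      by_contra! h
      exact hστ (Subtype.ext (Matrix.ext h))
    refine ⟨_, ⟨_, ⟨entry i j, StarAlgebra.subset_adjoin ℂ s ⟨(i, j), rfl⟩, rfl⟩, rfl⟩, hij⟩
  -- Since `s` is closed under `star`, its star algebra is spanned by monomials in the entries.
  · have hg' : g ∈ Submodule.span ℂ (Submonoid.closure s : Set _) := by
      rw [← Algebra.adjoin_eq_span, ← Set.union_eq_self_of_subset_right hstar,
        ← StarAlgebra.adjoin_toSubalgebra]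
      exact hg
    clear hg
    induction hg' using Submodule.span_induction with
    | mem f hf =>
      obtain ⟨n, μ, ν, h⟩ := exists_tensorPower_of_mem_closure hf
      simp_rw [h]
      -- The empty monomial is outside the representation, but both measures have mass one.
      rcases Nat.eq_zero_or_pos n with rfl | hn
      · simp [tensorPower]
      · rw [← hP.representation n hn, ← hQ.representation n hn]
    | zero => simp
    | add f g _ _ hf hg =>
      simp only [BoundedContinuousFunction.coe_add, Pi.add_apply]
      rw [integral_add (f.integrable P) (g.integrable P),
        integral_add (f.integrable Q) (g.integrable Q)]
      exact congrArg₂ _ hf hg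
    | smul c f _ hf =>
      simp only [BoundedContinuousFunction.coe_smul]
      rw [integral_smul, integral_smul, hf]

/-! ### Single-trial constraints. -/

theorem IsDeFinettiMeasure.integral_trace_mul {P : Measure (StateSpace d)}
    (hP : IsDeFinettiMeasure ρ P) (A : Matrix d d ℂ) :
    ∫ σ, (A * σ.1).trace ∂P = (A * singleTrial (ρ 1)).trace := by
  have := hP.isProbability
  have hint : ∀ i j, Integrable (fun σ : StateSpace d => A i j * σ.1 j i) P := fun i j =>
    StateSpace.integrable_of_continuous
      (continuous_const.mul (StateSpace.continuous_val.matrix_elem j i))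
  simp only [Matrix.trace, Matrix.diag, Matrix.mul_apply]
  rw [integral_finsetSum _ fun i _ => integrable_finsetSum _ fun j _ => hint i j]
  refine Finset.sum_congr rfl fun i _ => ?_
  rw [integral_finsetSum _ fun j _ => hint i j]
  refine Finset.sum_congr rfl fun j _ => ?_
  rw [integral_const_mul, singleTrial, Matrix.of_apply, hP.representation 1 le_rfl]
  simp [tensorPower]

/-- An observable bounded below by its mean value `r` has the value `r` in almost every state. -/
theorem IsDeFinettiMeasure.ae_trace_mul_eq {P : Measure (StateSpace d)}
    (hP : IsDeFinettiMeasure ρ P) {R : Matrix d d ℂ} {r : ℝ}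
    (hR : (R - (r : ℂ) • (1 : Matrix d d ℂ)).PosSemidef)
    (hr : (R * singleTrial (ρ 1)).trace = r) :
    ∀ᵐ σ ∂P, (R * σ.1).trace = (r : ℂ) := by
  have := hP.isProbability
  have hsub : ∀ σ : StateSpace d,
      ((R - (r : ℂ) • (1 : Matrix d d ℂ)) * σ.1).trace = (R * σ.1).trace - r := by
    intro σ
    rw [Matrix.sub_mul, Matrix.smul_mul, Matrix.one_mul, trace_sub, trace_smul, σ.2.2, smul_eq_mul,
      mul_one]
  have hnn : ∀ σ : StateSpace d, 0 ≤ (R * σ.1).trace - r := fun σ =>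
    hsub σ ▸ hR.trace_mul_nonneg σ.2.1
  have hcont : Continuous fun σ : StateSpace d => (R * σ.1).trace :=
    (continuous_const.matrix_mul StateSpace.continuous_val).matrix_trace
  have hint : Integrable (fun σ : StateSpace d => (R * σ.1).trace - r) P :=
    StateSpace.integrable_of_continuous (hcont.sub continuous_const)
  have h0 : ∫ σ, ((R * σ.1).trace - r) ∂P = 0 := by
    rw [integral_sub (StateSpace.integrable_of_continuous hcont) (integrable_const _),
      hP.integral_trace_mul, hr]
    simp
  have hre : ∫ σ, ((R * σ.1).trace - r).re ∂P = 0 := by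
    have h := integral_re (𝕜 := ℂ) hint
    rw [h0] at h
    simpa using h
  filter_upwards [(integral_eq_zero_iff_of_nonneg (fun σ => (Complex.nonneg_iff.mp (hnn σ)).1)
    hint.re).mp hre] with σ hσ
  exact sub_eq_zero.mp (Complex.ext hσ (Complex.nonneg_iff.mp (hnn σ)).2.symm)

-- The support lies in every closed set of full measure.
omit [DecidableEq d] in
theorem StateSpace.support_subset_of_ae_trace_mul_eq {P : Measure (StateSpace d)}
    {R : Matrix d d ℂ} {z : ℂ}
    (h : ∀ᵐ σ ∂P, (R * σ.1).trace = z) : P.support ⊆ {σ | (R * σ.1).trace = z} :=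
  Measure.support_subset_of_isClosed (isClosed_eq
    (continuous_const.matrix_mul StateSpace.continuous_val).matrix_trace continuous_const) h

end StateSpace

end QDeFinetti

theorem mainTheorem4 {d : Type*} [Fintype d] [DecidableEq d]
    (ρ : ∀ n : ℕ, QDeFinetti.TrialOp d n) (hρ : QDeFinetti.IsExchangeable ρ) :
    ∃ P : Measure (QDeFinetti.StateSpace d),
      -- `P` is the de Finetti measure of the sequence, and the only one
      QDeFinetti.IsDeFinettiMeasure ρ P ∧
      (∀ Q : Measure (QDeFinetti.StateSpace d), QDeFinetti.IsDeFinettiMeasure ρ Q → Q = P) ∧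
      -- a single-trial constraint with `R ≥ r` passes to the states that `P` is supported on
      (∀ (R : Matrix d d ℂ) (r : ℝ), R.IsHermitian →
        (R - (r : ℂ) • (1 : Matrix d d ℂ)).PosSemidef →
        (R * QDeFinetti.singleTrial (ρ 1)).trace = (r : ℂ) →
          (∀ᵐ σ ∂P, (R * σ.1).trace = (r : ℂ)) ∧
          P.support ⊆ {σ | (R * σ.1).trace = (r : ℂ)} ∧
          ∀ n, 1 ≤ n → ∀ μ ν : Fin n → d,
            ρ n μ ν = ∫ σ in {σ : QDeFinetti.StateSpace d | (R * σ.1).trace = (r : ℂ)},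
              QDeFinetti.tensorPower σ.1 n μ ν ∂P) ∧
      -- an outcome that never occurs in a single trial never occurs in the unknown state
      (∀ E : Matrix d d ℂ, QDeFinetti.IsEffect E →
        (E * QDeFinetti.singleTrial (ρ 1)).trace = 0 →
          (∀ᵐ σ ∂P, (E * σ.1).trace = 0) ∧ P.support ⊆ {σ | (E * σ.1).trace = 0}) := by
  obtain ⟨P, hP⟩ := hρ.exists_isDeFinettiMeasure
  refine ⟨P, hP, fun Q hQ => hQ.unique hP, fun R r _ hR hr => ?_, fun E hE h0 => ?_⟩
  · have h := hP.ae_trace_mul_eq hR hr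
    refine ⟨h, QDeFinetti.StateSpace.support_subset_of_ae_trace_mul_eq h, fun n hn μ ν => ?_⟩
    rw [Measure.restrict_eq_self_of_ae_mem
      (s := {σ : QDeFinetti.StateSpace d | (R * σ.1).trace = (r : ℂ)}) h]
    exact hP.representation n hn μ ν
  · have h : ∀ᵐ σ ∂P, (E * σ.1).trace = 0 := by
      -- An effect is an observable whose lower bound `0` is attained by its mean.
      simpa using hP.ae_trace_mul_eq (r := 0) (by simpa using hE.1) (by simpa using h0)
    exact ⟨h, QDeFinetti.StateSpace.support_subset_of_ae_trace_mul_eq h⟩
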